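/- Corollary (Covering arrays of strength 3). Let $q$ be a prime power, let $\alpha$ be a primitive element of $\mathbb{F}_{q^3}$ (a generator of $\mathbb{F}_{q^3}^\times$), and let $v$ be a positive divisor of $q-1$ such that $q \ge v^4+6v^3+9v^2$. Put $w = \frac{q^3-1}{q-1} = q^2+q+1$ and $\omega = \alpha^{w}$, which is a primitive element of $\mathbb{F}_q$; for $x \in \mathbb{F}_q^\times$ let $\log_\omega x$ be the unique $i \in \{0,\dots,q-2\}$ with $\omega^i = x$, and let $\mathrm{Tr}$ be the trace from $\mathbb{F}_{q^3}$ to $\mathbb{F}_q$. Let $\mathcal{A}_{q^3/q}(\alpha;v)$, the principal cyclic trace array modulo $v$, be the $vw \times w$ array with entries $$\mathcal{A}_{q^3/q}(\alpha;v)_{ij} = \begin{cases} \log_\omega\!\big(\mathrm{Tr}(\alpha^{i+j})\big) \bmod v, & \text{if } \mathrm{Tr}(\alpha^{i+j}) \ne 0,\\ 0, & \text{otherwise,}\end{cases} \qquad 0 \le i \le vw-1,\ 0 \le j \le w-1.$$ Then $\mathcal{A}_{q^3/q}(\alpha;v)$ is a $\mathrm{CA}(v(q^2+q+1);\, 3,\,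 q^2+q+1,\, v)$ over the alphabet $\{0,\dots,v-1\}$. Here, for a positive integer $t$ with $t \le k$ and $v^t \le N$, a $\mathrm{CA}(N; t, k, v)$ is an $N \times k$ array with entries from an alphabet of cardinality $v$ such that, in the $N\times t$ subarray formed by any $t$ distinct columns, each of the $v^t$ $t$-tuples over the alphabet appears at least once as a row. -/

import Mathlib

/-- `α` is a primitive element of the field `F`: a generator of the multiplicative group of `F`. -/
def IsPrimitiveElement {F : Type*} [Field F] (α : F) : Prop :=
  ∃ u : Fˣ, (u : F) = α ∧ Subgroup.zpowers u = ⊤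

/-- The number `(q ^ t - 1) / (q - 1) = 1 + q + ⋯ + q ^ (t - 1)` (the division is exact for
`q ≥ 2`). -/
def projCard (q t : ℕ) : ℕ := (q ^ t - 1) / (q - 1)

/-- The discrete logarithm of `x` with base `ω`: the least natural number `i` with `ω ^ i = x`.
If `ω` is a primitive element of a field with `q` elements and `x` is a nonzero element of it, this
is the unique `i` with `0 ≤ i ≤ q - 2` and `ω ^ i = x`. -/
noncomputable def discreteLog {F : Type*} [Field F] (ω x : F) : ℕ :=
  sInf {i : ℕ | ω ^ i = x}

open Classical in
/-- The cyclic trace array modulo `v` of `α` with the columns given by the exponents `c j`, for an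
extension `L / K` of finite fields with `Nat.card K = q` and degree `t`. With
`w = (q ^ t - 1) / (q - 1)`, it has `v * w` rows, and its `(i, j)` entry is the remainder modulo `v`
of the logarithm of `Tr (α ^ (i + c j))` with base `ω = α ^ w` if this trace is nonzero, and `0`
otherwise. The element `ω` lies in (the image of) `K`, and the logarithm is taken in `L`. -/
noncomputable def cyclicTraceArrayMod (K : Type*) {L : Type*} [Field K] [Field L] [Algebra K L]
    (α : L) (v : ℕ) {ι : Type*} (c : ι → ℕ) :
    Matrix (Fin (v * projCard (Nat.card K) (Module.finrank K L))) ι ℕ :=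
  Matrix.of fun i j =>
    if Algebra.trace K L (α ^ ((i : ℕ) + c j)) = 0 then 0
    else
      discreteLog (α ^ projCard (Nat.card K) (Module.finrank K L))
        (algebraMap K L (Algebra.trace K L (α ^ ((i : ℕ) + c j)))) % v

/-- The principal cyclic trace array modulo `v` of `α`: the columns are given by the exponents
`0, 1, …, w - 1`, where `w = (q ^ t - 1) / (q - 1)`. -/
noncomputable def principalCyclicTraceArrayMod (K : Type*) {L : Type*} [Field K] [Field L]
    [Algebra K L] (α : L) (v : ℕ) :
    Matrix (Fin (v * projCard (Nat.card K) (Module.finrank K L)))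
      (Fin (projCard (Nat.card K) (Module.finrank K L))) ℕ :=
  cyclicTraceArrayMod K α v fun j => (j : ℕ)

/-- The array `A` is a `CA(N; t, k, v)` over the alphabet `V`: it is an `N × k` array with entries
from the alphabet `V` of cardinality `v`, where `1 ≤ t ≤ k` and `v ^ t ≤ N`, and in the subarray
formed by any `t` distinct columns every `t`-tuple over `V` appears at least once as a row. -/
structure IsCoveringArray {X R C : Type*} [Fintype R] [Fintype C] (V : Finset X)
    (A : Matrix R C X) (N t k v : ℕ) : Prop where
  card_rows : Fintype.card R = N
  card_columns : Fintype.card C = k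
  card_alphabet : V.card = v
  entry_mem : ∀ i j, A i j ∈ V
  strength_pos : 0 < t
  strength_le : t ≤ k
  pow_le : v ^ t ≤ N
  covered : ∀ c : Fin t → C, Function.Injective c →
    ∀ x : Fin t → X, (∀ s, x s ∈ V) → ∃ i, ∀ s, A i (c s) = x s

/-! Rows are indexed by multipliers `β = α ^ i` and columns by points `α ^ j` of the projective
plane over `K`; entries are logarithms mod `v` of `Tr (β * α ^ j)`. Three non-collinear points allow
arbitrary traces, as the trace form is nondegenerate. For collinear points `γ 2 = a • γ 0 + b • γ 1`
with `a, b ≠ 0`, the traces satisfy the same relation, so a solution in three prescribed cosets of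
the `v`-th powers is needed; the incidence bound provides it
(`IsPrimitiveElement.exists_linear_relation`). Finally `α ^ (v * w) = ω ^ v` preserves logarithms
mod `v`, so `v * w` rows represent every `β ≠ 0`. -/

open Finset in
/-- A second-moment bound for point-line incidences in the affine plane over a finite field: four
subsets of the field, the product of whose sizes exceeds `q ^ 3`, solve `x + m * y = t`. -/
theorem exists_add_mul_mem_of_card_pow_lt {K : Type*} [Field K] [Fintype K]
    (A B M C : Finset K) (h : Fintype.card K ^ 3 < (#M * #C) * (#A * #B)) :
    ∃ x ∈ A, ∃ y ∈ B, ∃ m ∈ M, x + m * y ∈ C := by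
  classical
  by_contra! hno
  set q : ℤ := (Fintype.card K : ℤ) with hq
  set n : ℤ := (#(A ×ˢ B) : ℤ) with hn
  let N : K → K → ℤ := fun m t => ∑ p ∈ A ×ˢ B, if p.1 + m * p.2 = t then 1 else 0
  have hsum : ∑ m, ∑ t, N m t = q * n := by
    have h1 : ∀ m, ∑ t, N m t = n := fun m => by
      simp only [N]
      rw [sum_comm]
      simp [hn]
    simp [h1, hq]
  have hsq : ∑ m, ∑ t, N m t ^ 2 ≤ n ^ 2 + q * n := by
    have h1 : ∀ m, ∑ t, N m t ^ 2 = ∑ p ∈ A ×ˢ B, ∑ p' ∈ A ×ˢ B,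
        if p.1 + m * p.2 = p'.1 + m * p'.2 then 1 else 0 := fun m => by
      simp only [N, pow_two, sum_mul_sum]
      rw [sum_comm]
      refine sum_congr rfl fun p _ => ?_
      rw [sum_comm]
      refine sum_congr rfl fun p' _ => ?_
      simp [eq_comm]
    -- Two distinct points lie on at most one common line `x + m * y = t`.
    have h2 : ∀ p p' : K × K, (∑ m : K, if p.1 + m * p.2 = p'.1 + m * p'.2 then (1 : ℤ) else 0)
        ≤ 1 + if p = p' then q else 0 := by
      rintro ⟨x, y⟩ ⟨x', y'⟩
      rw [sum_boole]
      by_cases hp : (x, y) = (x', y')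
      · rw [if_pos hp]
        have := card_le_univ {m : K | x + m * y = x' + m * y'}
        rw [hq]
        exact_mod_cast this.trans (by omega)
      · rw [if_neg hp, add_zero, ← Nat.cast_one, Nat.cast_le, card_le_one]
        intro m hm m' hm'
        simp only [mem_filter, mem_univ, true_and] at hm hm'
        by_cases hy : y = y'
        · subst hy
          exact absurd (by simpa using hm) hp
        · refine mul_right_cancel₀ (sub_ne_zero.2 hy) ?_
          linear_combination hm - hm'
    calc ∑ m, ∑ t, N m t ^ 2
        = ∑ p ∈ A ×ˢ B, ∑ p' ∈ A ×ˢ B,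
            ∑ m : K, if p.1 + m * p.2 = p'.1 + m * p'.2 then (1 : ℤ) else 0 := by
          simp only [h1]
          rw [sum_comm]
          exact sum_congr rfl fun p _ => sum_comm
      _ ≤ ∑ p ∈ A ×ˢ B, ∑ p' ∈ A ×ˢ B, (1 + if p = p' then q else 0) :=
          sum_le_sum fun p _ => sum_le_sum fun p' _ => h2 p p'
      _ = n ^ 2 + q * n := by
          have : ∀ p ∈ A ×ˢ B, ∑ p' ∈ A ×ˢ B, ((1 : ℤ) + if p = p' then q else 0) = n + q := by
            intro p hp
            rw [sum_add_distrib, sum_ite_eq, if_pos hp]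
            simp [hn]
          rw [sum_congr rfl this, sum_const, nsmul_eq_mul, ← hn]
          ring
  -- The mean of `N` is `n / q`; the factor `q` keeps the deviation integral.
  have hvar : ∑ m, ∑ t, (q * N m t - n) ^ 2 ≤ q ^ 3 * n := by
    have h1 : ∑ m, ∑ t, (q * N m t - n) ^ 2 =
        q ^ 2 * (∑ m, ∑ t, N m t ^ 2) - 2 * q * n * (∑ m, ∑ t, N m t) + q ^ 2 * n ^ 2 := by
      have h2 : ∀ m t, (q * N m t - n) ^ 2 =
          q ^ 2 * N m t ^ 2 - 2 * q * n * N m t + n ^ 2 := fun m t => by ring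
      simp only [h2, sum_add_distrib, sum_sub_distrib, ← mul_sum, sum_const, card_univ,
        nsmul_eq_mul, ← hq]
      ring
    rw [h1, hsum]
    nlinarith [mul_le_mul_of_nonneg_left hsq (sq_nonneg q)]
  have hlow : (#M * #C : ℤ) * n ^ 2 ≤ ∑ m, ∑ t, (q * N m t - n) ^ 2 := by
    have h0 : ∀ m ∈ M, ∀ t ∈ C, N m t = 0 := fun m hm t ht => by
      refine sum_eq_zero fun p hp => if_neg ?_
      rintro rfl
      rw [mem_product] at hp
      exact hno _ hp.1 _ hp.2 _ hm ht
    calc (#M * #C : ℤ) * n ^ 2 = ∑ m ∈ M, ∑ t ∈ C, (q * N m t - n) ^ 2 := by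
          rw [sum_congr rfl fun m hm => sum_congr rfl fun t ht => by rw [h0 m hm t ht]]
          simp [mul_assoc]
      _ ≤ ∑ m ∈ M, ∑ t, (q * N m t - n) ^ 2 :=
          sum_le_sum fun m _ => sum_le_univ_sum_of_nonneg fun t => sq_nonneg _
      _ ≤ _ := sum_le_univ_sum_of_nonneg fun m => sum_nonneg fun t _ => sq_nonneg _
  have h' : q ^ 3 < (#M * #C : ℤ) * n := by
    rw [hq, hn, card_product]
    exact_mod_cast h
  have hn0 : 0 < n := by
    rcases (Nat.cast_nonneg (α := ℤ) #(A ×ˢ B)).lt_or_eq with h0 | h0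
    · exact h0
    · rw [hn, ← h0, mul_zero] at h'
      exact absurd h' (not_lt.2 (by positivity))
  nlinarith [mul_lt_mul_of_pos_right h' hn0]

/-- The traces of the multiples of linearly independent elements take arbitrary values. -/
theorem LinearIndependent.exists_trace_mul_eq {K L ι : Type*} [Field K] [Field L] [Algebra K L]
    [FiniteDimensional K L] [Algebra.IsSeparable K L] {γ : ι → L} (hγ : LinearIndependent K γ)
    (z : ι → K) : ∃ β : L, ∀ s, Algebra.trace K L (β * γ s) = z s := by
  -- Extend `γ s ↦ z s` to a functional on `L` and represent it by the trace form.
  obtain ⟨f, hf⟩ := LinearMap.exists_extend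
    ((Module.Basis.span hγ).constr K z : Submodule.span K (Set.range γ) →ₗ[K] K)
  refine ⟨((Algebra.traceForm K L).toDual (traceForm_nondegenerate K L)).symm f, fun s => ?_⟩
  rw [← Algebra.traceForm_apply, LinearMap.BilinForm.apply_toDual_symm_apply,
    ← (Module.Basis.span hγ).constr_basis K z s, ← hf, Module.Basis.span_apply]
  simp

/-! ### Primitive elements, logarithms and projective points -/

section PrimitiveElement

variable {F : Type*} [Field F] {α : F}

theorem IsPrimitiveElement.ne_zero (hα : IsPrimitiveElement α) : α ≠ 0 := by
  obtain ⟨u, rfl, -⟩ := hα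
  exact u.ne_zero

theorem IsPrimitiveElement.orderOf_eq (hα : IsPrimitiveElement α) :
    orderOf α = Nat.card F - 1 := by
  obtain ⟨u, rfl, hu⟩ := hα
  rw [orderOf_units, ← Nat.card_units, ← Nat.card_zpowers, hu, Subgroup.card_top]

theorem IsPrimitiveElement.exists_pow_eq [Finite F] (hα : IsPrimitiveElement α) {x : F}
    (hx : x ≠ 0) : ∃ i : ℕ, α ^ i = x := by
  obtain ⟨u, rfl, hu⟩ := hα
  have : Units.mk0 x hx ∈ Subgroup.zpowers u := hu ▸ Subgroup.mem_top _
  obtain ⟨i, hi⟩ := mem_powers_iff_mem_zpowers.2 this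
  exact ⟨i, by simpa using congrArg Units.val hi⟩

/-- The logarithm modulo a divisor of the order of the base can be read off from any exponent. -/
theorem discreteLog_pow_mod {v : ℕ} (hα : α ≠ 0) (hv : v ∣ orderOf α) (i : ℕ) :
    discreteLog α (α ^ i) % v = i % v := by
  have h : α ^ discreteLog α (α ^ i) = α ^ i := Nat.sInf_mem (s := {j | α ^ j = α ^ i}) ⟨i, rfl⟩
  have h' : Units.mk0 α hα ^ discreteLog α (α ^ i) = Units.mk0 α hα ^ i := by
    ext
    simpa using h
  rw [pow_eq_pow_iff_modEq, ← orderOf_units, Units.val_mk0] at h'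
  exact h'.of_dvd hv

theorem discreteLog_map {E : Type*} [Field E] (f : F →+* E) (x : F) :
    discreteLog (f α) (f x) = discreteLog α x := by
  simp only [discreteLog, ← map_pow, f.injective.eq_iff]

variable {K : Type*} [Field K] [Algebra K F] [Finite F]

theorem IsPrimitiveElement.norm (hα : IsPrimitiveElement α) :
    IsPrimitiveElement (Algebra.norm K α) := by
  obtain ⟨u, rfl, hu⟩ := hα
  refine ⟨Units.map (Algebra.norm K) u, rfl, ?_⟩
  rw [← MonoidHom.map_zpowers, hu,
    Subgroup.map_top_of_surjective _ (FiniteField.unitsMap_norm_surjective K F)]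

theorem projCard_eq_sum {q : ℕ} (hq : 2 ≤ q) (t : ℕ) :
    projCard q t = ∑ i ∈ Finset.range t, q ^ i :=
  (Nat.geomSum_eq hq t).symm

/-- The norm is the product of the conjugates `x ^ (q ^ i)`. Hence `ω = α ^ w` is the norm of `α`,
and logarithms can be taken in `K`. -/
theorem pow_projCard_eq_algebraMap_norm (x : F) :
    x ^ projCard (Nat.card K) (Module.finrank K F) = algebraMap K F (Algebra.norm K x) := by
  have := Finite.of_injective _ (algebraMap K F).injective
  rw [FiniteField.algebraMap_norm_eq_pow_sum, projCard_eq_sum Finite.one_lt_card]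

/-- Powers of a primitive element with distinct exponents below `projCard q t` are distinct points
of the projective space. -/
theorem IsPrimitiveElement.smul_pow_ne_pow (hα : IsPrimitiveElement α) {a b : ℕ}
    (ha : a < projCard (Nat.card K) (Module.finrank K F))
    (hb : b < projCard (Nat.card K) (Module.finrank K F)) (hab : a ≠ b) (k : K) :
    k • α ^ a ≠ α ^ b := by
  intro h
  have hfin := Finite.of_injective _ (algebraMap K F).injective
  have := Fintype.ofFinite K
  have hK : 1 < Nat.card K := Finite.one_lt_card
  have hk : k ≠ 0 := by
    rintro rfl
    rw [zero_smul] at h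
    exact pow_ne_zero b hα.ne_zero h.symm
  have hw : (Nat.card K - 1) * projCard (Nat.card K) (Module.finrank K F) = orderOf α := by
    rw [hα.orderOf_eq, projCard, Module.natCard_eq_pow_finrank (K := K) (V := F)]
    exact Nat.mul_div_cancel' (by simpa using Nat.sub_dvd_pow_sub_pow (Nat.card K) 1 _)
  -- The power `q - 1` kills the scalar `k`.
  have h1 : α ^ ((Nat.card K - 1) * a) = α ^ ((Nat.card K - 1) * b) := by
    rw [mul_comm, pow_mul, mul_comm, pow_mul, ← h, smul_pow, Nat.card_eq_fintype_card,
      FiniteField.pow_card_sub_one_eq_one k hk, one_smul]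
  have h2 := pow_injOn_Iio_orderOf
    (Set.mem_Iio.2 (hw ▸ Nat.mul_lt_mul_of_pos_left ha (by omega)))
    (Set.mem_Iio.2 (hw ▸ Nat.mul_lt_mul_of_pos_left hb (by omega))) h1
  exact hab (Nat.eq_of_mul_eq_mul_left (by omega) h2)

end PrimitiveElement

/-! ### Prescribed cosets for three traces -/

/-- Over a field with more than `v ^ 4 + 4` elements a linear equation in three unknowns with
nonzero coefficients is solvable in prescribed cosets of the group of `v`-th powers. -/
theorem IsPrimitiveElement.exists_linear_relation {K : Type*} [Field K] [Finite K] {ω : K}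
    (hω : IsPrimitiveElement ω) {v : ℕ} (hv : 0 < v) (hvq : v ∣ Nat.card K - 1)
    (hbound : v ^ 4 + 4 < Nat.card K) {a b : K} (ha : a ≠ 0) (hb : b ≠ 0) (i j l : ℕ) :
    ∃ i' j' l' : ℕ,
      a * ω ^ (i + v * i') + b * ω ^ (j + v * j') = ω ^ (l + v * l') := by
  classical
  have := Fintype.ofFinite K
  obtain ⟨n, hn⟩ := hvq
  have hω0 := hω.ne_zero
  let S : K → Finset K := fun c => (Finset.range n).image fun k => c * ω ^ (v * k)
  have hS : ∀ c, c ≠ 0 → (S c).card = n := fun c hc => by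
    rw [Finset.card_image_of_injOn, Finset.card_range]
    intro k hk k' hk' h
    simp only [Finset.coe_range, Set.mem_Iio] at hk hk'
    have h1 := pow_injOn_Iio_orderOf
      (Set.mem_Iio.2 (by rw [hω.orderOf_eq, hn]; exact Nat.mul_lt_mul_of_pos_left hk hv))
      (Set.mem_Iio.2 (by rw [hω.orderOf_eq, hn]; exact Nat.mul_lt_mul_of_pos_left hk' hv))
      (mul_left_cancel₀ hc h)
    exact Nat.eq_of_mul_eq_mul_left hv h1
  have hcard : Fintype.card K ^ 3 < (n * n) * (n * n) := by
    rw [← Nat.card_eq_fintype_card]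
    obtain ⟨r, hr⟩ : ∃ r, Nat.card K = r + 1 := ⟨_, (Nat.succ_pred_eq_of_pos Nat.card_pos).symm⟩
    rw [hr] at hn hbound ⊢
    rw [Nat.add_sub_cancel] at hn
    have hv4 : 0 < v ^ 4 := by positivity
    -- With `r = q - 1 = v * n`, the factor `v ^ 4` turns `n ^ 4` into `r ^ 4`, and `hbound` says `v
    -- ^ 4 ≤ r - 4`.
    refine lt_of_mul_lt_mul_left (a := v ^ 4) ?_ (Nat.zero_le _)
    calc v ^ 4 * (r + 1) ^ 3 ≤ (r - 4) * (r + 1) ^ 3 := by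
          gcongr
          omega
      _ < r ^ 4 := by
          obtain ⟨s, rfl⟩ : ∃ s, r = s + 4 := ⟨r - 4, by omega⟩
          rw [Nat.add_sub_cancel]
          nlinarith [Nat.zero_le (s ^ 3), Nat.zero_le (s ^ 2), Nat.zero_le s]
      _ = v ^ 4 * ((n * n) * (n * n)) := by rw [hn]; ring
  -- The slopes `S 1` are the `v`-th powers, so `m * y` stays in the coset of `y`: the fourth set
  -- costs nothing.
  obtain ⟨x, hx, y, hy, m, hm, ht⟩ := exists_add_mul_mem_of_card_pow_lt
    (S (a * ω ^ i)) (S (b * ω ^ j)) (S 1) (S (ω ^ l)) (by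
      rw [hS _ (mul_ne_zero ha (pow_ne_zero _ hω0)), hS _ (mul_ne_zero hb (pow_ne_zero _ hω0)),
        hS _ one_ne_zero, hS _ (pow_ne_zero _ hω0)]
      exact hcard)
  simp only [S, Finset.mem_image] at hx hy hm ht
  obtain ⟨i', -, rfl⟩ := hx
  obtain ⟨j', -, rfl⟩ := hy
  obtain ⟨m', -, rfl⟩ := hm
  obtain ⟨l', -, ht⟩ := ht
  refine ⟨i', j' + m', l', ?_⟩
  rw [pow_add ω l, ht]
  ring

/-- For three pairwise non-proportional elements of an extension of a finite field, some common
multiple has traces in prescribed cosets of the group of `v`-th powers. -/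
theorem IsPrimitiveElement.exists_trace_mul_eq_pow {K L : Type*} [Field K] [Finite K] [Field L]
    [Algebra K L] [FiniteDimensional K L] {ω : K} (hω : IsPrimitiveElement ω) {v : ℕ} (hv : 0 < v)
    (hvq : v ∣ Nat.card K - 1) (hbound : v ^ 4 + 4 < Nat.card K) {γ : Fin 3 → L}
    (hγ0 : ∀ s, γ s ≠ 0) (hγ : ∀ s s', s ≠ s' → ∀ k : K, k • γ s ≠ γ s') (x : Fin 3 → ℕ) :
    ∃ β : L, ∀ s, ∃ k, Algebra.trace K L (β * γ s) = ω ^ (x s + v * k) := by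
  by_cases hli : LinearIndependent K γ
  · obtain ⟨β, hβ⟩ := hli.exists_trace_mul_eq fun s => ω ^ x s
    exact ⟨β, fun s => ⟨0, by simp [hβ]⟩⟩
  have hpair : LinearIndependent K ![γ 0, γ 1] :=
    (LinearIndependent.pair_iff' (hγ0 0)).2 (hγ 0 1 (by decide))
  have hinit : Fin.init γ = ![γ 0, γ 1] := by
    ext s
    fin_cases s <;> rfl
  rw [linearIndependent_finSucc', hinit, not_and, not_not] at hli
  have hspan := hli hpair
  rw [Matrix.range_cons_cons_empty, Submodule.mem_span_pair] at hspan
  obtain ⟨a, b, hab⟩ := hspan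
  have ha : a ≠ 0 := by
    rintro rfl
    exact hγ 1 2 (by decide) b (by simpa using hab)
  have hb : b ≠ 0 := by
    rintro rfl
    exact hγ 0 2 (by decide) a (by simpa using hab)
  obtain ⟨i, j, l, h⟩ := hω.exists_linear_relation hv hvq hbound ha hb (x 0) (x 1) (x 2)
  obtain ⟨β, hβ⟩ := hpair.exists_trace_mul_eq ![ω ^ (x 0 + v * i), ω ^ (x 1 + v * j)]
  have hβ0 : Algebra.trace K L (β * γ 0) = ω ^ (x 0 + v * i) := hβ 0
  have hβ1 : Algebra.trace K L (β * γ 1) = ω ^ (x 1 + v * j) := hβ 1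
  have hβ2 : Algebra.trace K L (β * γ 2) = ω ^ (x 2 + v * l) := by
    rw [← h, show γ 2 = a • γ 0 + b • γ 1 from hab.symm, mul_add, mul_smul_comm, mul_smul_comm,
      map_add, map_smul, map_smul, hβ0, hβ1, smul_eq_mul, smul_eq_mul]
  refine ⟨β, fun s => ?_⟩
  fin_cases s
  exacts [⟨i, hβ0⟩, ⟨j, hβ1⟩, ⟨l, hβ2⟩]

/-! ### From multipliers to rows -/

/-- Entries of the cyclic trace array, computed with logarithms in the base field. -/
theorem cyclicTraceArrayMod_eq_of_trace_eq_pow {K L : Type*} [Field K] [Field L] [Finite L]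
    [Algebra K L] {α : L} (hα : IsPrimitiveElement α) {v : ℕ} (hvq : v ∣ Nat.card K - 1)
    {ι : Type*} (c : ι → ℕ)
    (i : Fin (v * projCard (Nat.card K) (Module.finrank K L))) (j : ι) {d : ℕ}
    (h : Algebra.trace K L (α ^ ((i : ℕ) + c j)) = Algebra.norm K α ^ d) :
    cyclicTraceArrayMod K α v c i j = d % v := by
  have hω : IsPrimitiveElement (Algebra.norm K α) := hα.norm
  rw [cyclicTraceArrayMod, Matrix.of_apply, h, if_neg (pow_ne_zero _ hω.ne_zero),
    pow_projCard_eq_algebraMap_norm, discreteLog_map,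
    discreteLog_pow_mod hω.ne_zero (hω.orderOf_eq ▸ hvq)]

/-- Reducing the exponent of `β` mod `v * w` divides the traces by a power of `ω ^ v`, which leaves
their logarithms mod `v` unchanged. -/
theorem exists_row_cyclicTraceArrayMod {K L : Type*} [Field K] [Field L] [Finite L]
    [Algebra K L] {α : L} (hα : IsPrimitiveElement α) {v : ℕ} (hv : 0 < v)
    (hvq : v ∣ Nat.card K - 1) {ι σ : Type*} (c : ι → ℕ) (e : σ → ι) (x : σ → ℕ)
    (hx : ∀ s, x s < v) {β : L} (hβ : β ≠ 0)
    (h : ∀ s, ∃ k, Algebra.trace K L (β * α ^ c (e s)) = Algebra.norm K α ^ (x s + v * k)) :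
    ∃ i, ∀ s, cyclicTraceArrayMod K α v c i (e s) = x s := by
  have := Finite.of_injective _ (algebraMap K L).injective
  have hω : IsPrimitiveElement (Algebra.norm K α) := hα.norm
  set ω := Algebra.norm K α
  set w := projCard (Nat.card K) (Module.finrank K L) with hw
  have hw0 : 0 < w := by
    rw [hw, projCard_eq_sum Finite.one_lt_card]
    exact Finset.sum_pos (fun i _ => pow_pos Nat.card_pos i)
      (Finset.nonempty_range_iff.2 Module.finrank_pos.ne')
  obtain ⟨m, rfl⟩ := hα.exists_pow_eq hβ
  refine ⟨⟨m % (v * w), Nat.mod_lt _ (by positivity)⟩, fun s => ?_⟩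
  obtain ⟨k, hk⟩ := h s
  set n := m / (v * w)
  have hper : ω ^ (v * n) * Algebra.trace K L (α ^ (m % (v * w) + c (e s))) =
      ω ^ (x s + v * k) := by
    rw [← hk, ← smul_eq_mul, ← map_smul, Algebra.smul_def, map_pow,
      ← pow_projCard_eq_algebraMap_norm, ← hw, ← pow_mul, ← pow_add, ← pow_add]
    rw [← add_assoc, ← mul_assoc, mul_comm w v, Nat.div_add_mod]
  -- As `ω ^ (r + 1) = 1`, the inverse of `ω ^ (v * n)` is `ω ^ (v * n * r)`, with a natural
  -- exponent.
  obtain ⟨r, hr⟩ : ∃ r, Nat.card K - 1 = r + 1 :=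
    ⟨Nat.card K - 2, by have := Finite.one_lt_card (α := K); omega⟩
  have hone : ω ^ (v * n * (r + 1)) = 1 := by
    rw [mul_comm, pow_mul, ← hr, ← hω.orderOf_eq, pow_orderOf_eq_one, one_pow]
  have hd : Algebra.trace K L (α ^ (m % (v * w) + c (e s))) = ω ^ (x s + v * (k + n * r)) := by
    refine mul_left_cancel₀ (pow_ne_zero (v * n) hω.ne_zero) ?_
    rw [hper, ← pow_add, show v * n + (x s + v * (k + n * r)) = x s + v * k + v * n * (r + 1) by
      ring, pow_add _ (x s + v * k), hone, mul_one]
  rw [cyclicTraceArrayMod_eq_of_trace_eq_pow hα hvq c _ _ hd, Nat.add_mul_mod_self_left,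
    Nat.mod_eq_of_lt (hx s)]

theorem mainTheorem2 {K L : Type*} [Field K] [Finite K] [Field L] [Algebra K L]
    (q v : ℕ) (hq : Nat.card K = q) (hL : Module.finrank K L = 3)
    (α : L) (hα : IsPrimitiveElement α)
    (hv : 0 < v) (hvq : v ∣ q - 1) (hbound : v ^ 4 + 6 * v ^ 3 + 9 * v ^ 2 ≤ q) :
    IsCoveringArray (Finset.range v) (principalCyclicTraceArrayMod K α v)
      (v * (q ^ 2 + q + 1)) 3 (q ^ 2 + q + 1) v := by
  have hfd : FiniteDimensional K L := Module.finite_of_finrank_pos (by omega)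
  have hfin : Finite L := Module.finite_of_finite K
  subst hq
  have hK : 1 < Nat.card K := Finite.one_lt_card
  have hw : projCard (Nat.card K) (Module.finrank K L) = Nat.card K ^ 2 + Nat.card K + 1 := by
    rw [projCard_eq_sum hK, hL]
    simp [Finset.sum_range_succ]
    ring
  have hv1 : 1 ≤ v ^ 2 := Nat.one_le_pow _ _ hv
  refine ⟨by simp [hw], by simp [hw], Finset.card_range v, fun i j => ?_, by norm_num, by nlinarith,
    ?_, fun c hc x hx => ?_⟩
  · rw [principalCyclicTraceArrayMod, cyclicTraceArrayMod, Matrix.of_apply, Finset.mem_range]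
    split_ifs
    exacts [hv, Nat.mod_lt _ hv]
  · have : v ^ 2 ≤ Nat.card K := by nlinarith [Nat.zero_le (v ^ 4), Nat.zero_le (v ^ 3)]
    rw [pow_succ' v 2]
    exact Nat.mul_le_mul_left v (by nlinarith)
  · obtain ⟨β, hβ⟩ := (hα.norm (K := K)).exists_trace_mul_eq_pow (L := L) hv hvq
      (by nlinarith [Nat.zero_le (v ^ 3)]) (γ := fun s => α ^ (c s : ℕ))
      (fun s => pow_ne_zero _ hα.ne_zero)
      (fun s s' hs => hα.smul_pow_ne_pow (c s).2 (c s').2 fun h => hs (hc (Fin.ext h))) x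
    refine exists_row_cyclicTraceArrayMod hα hv hvq _ c x (fun s => Finset.mem_range.1 (hx s))
      ?_ hβ
    -- For `β = 0` the traces vanish, but powers of `ω` do not.
    rintro rfl
    obtain ⟨k, hk⟩ := hβ 0
    rw [zero_mul, map_zero] at hk
    exact pow_ne_zero _ (hα.norm (K := K)).ne_zero hk.symm
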